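/- Consider $n$ rankable objects that appear one at a time, at times $1,\dots,n$, in an order such that all $n!$ permutations are equally likely. Only relative ranks are observed; an object is a *candidate* if it is the best of those that have appeared so far. At most $m$ objects may be selected, one after another, at stopping times of the sequence of relative ranks, and only a candidate may be selected, at the moment it appears. A candidate selected at time $i$ yields $T_n(i)-i$, where $T_n(i)$ is the arrival time of the first candidate after time $i$ (and $T_n(i)=n+1$ if there is none), and each selection incurs an acquisition cost $c(n)$. Let $q_m(n)$ be the supremum, over all such selection strategies, of the expected total net payoff. Suppose that $c(n)/n\to c$ as $n\to\infty$, where $0<c\le e^{-1}$. Then the equation $-x\ln x=c$ has a unique root $\beta$ in $[e^{-1},1)$ and a unique root $\beta'$ in $(0,e^{-1}]$; for every $m$ the limit $q_m^*=\lim_{n\to\infty} q_m(n)/n$ exists; and $q_m^*$ converges as $m\to\infty$ to $$q_\infty^*=(\beta-\beta')\left(1-\frac{c^2}{\beta\beta'}\right).$$ -/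

import Mathlib

/-!
The multiple-choice duration problem with acquisition cost.

`n` rankable objects appear one at a time, in a uniformly random order.  An outcome is a
permutation `σ` of `Fin n`: the object that appears at the time with (zero-based) index `i` has
absolute rank `σ i`, and `0` is the best rank.  Only relative ranks are observed.
-/

namespace DurationProblem

/-- The relative rank, among the objects observed so far, of the object that appears at time `i`
(relative rank `1` is the best). -/
def relRank {n : ℕ} (σ : Equiv.Perm (Fin n)) (i : Fin n) : ℕ :=
  (Finset.univ.filter fun j : Fin n => j ≤ i ∧ σ j ≤ σ i).card

/-- The object that appears at time `i` is a candidate if it is relatively best. -/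
def IsCandidate {n : ℕ} (σ : Equiv.Perm (Fin n)) (i : Fin n) : Prop :=
  relRank σ i = 1

/-- The arrival time of the first candidate after time `i` if there is one, and the time `n` just
after the last arrival (times are numbered `0, …, n - 1`) if there is none. -/
noncomputable def nextCandidate {n : ℕ} (σ : Equiv.Perm (Fin n)) (i : Fin n) : ℕ :=
  sInf {t : ℕ | t = n ∨ ∃ j : Fin n, i < j ∧ IsCandidate σ j ∧ t = (j : ℕ)}

/-- The time during which a candidate selected at time `i` stays relatively best. -/
noncomputable def duration {n : ℕ} (σ : Equiv.Perm (Fin n)) (i : Fin n) : ℝ :=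
  (nextCandidate σ i : ℝ) - (i : ℝ)

/-- The information available at time `i`: the σ-algebra generated by the relative ranks of the
objects that have appeared up to and including time `i`. -/
def rankFiltration (n : ℕ) :
    MeasureTheory.Filtration (Fin n) (⊤ : MeasurableSpace (Equiv.Perm (Fin n))) where
  seq i := MeasurableSpace.comap
    (fun (σ : Equiv.Perm (Fin n)) (j : {j : Fin n // j ≤ i}) => relRank σ j.1) ⊤
  mono' := by
    intro i k hik s hs
    obtain ⟨t, -, rfl⟩ := hs
    exact ⟨(fun x (j : {j : Fin n // j ≤ i}) => x ⟨j.1, j.2.trans hik⟩) ⁻¹' t,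
      MeasurableSpace.measurableSet_top, rfl⟩
  le' := fun _ => le_top

/-- Stopping vectors for at most `m` choices: `τ k` is the time of the choice number `k + 1`, with
value `⊤` if that choice is never made.  Each `τ k` is a stopping time with respect to the observed
relative ranks, successive choices are made at strictly increasing times, and only candidates can
be chosen. -/
structure IsStoppingVector {n m : ℕ} (τ : Fin m → Equiv.Perm (Fin n) → WithTop (Fin n)) :
    Prop where
  isStoppingTime : ∀ k, MeasureTheory.IsStoppingTime (rankFiltration n) (τ k)
  increasing : ∀ k l, k < l → ∀ σ, τ l σ ≠ ⊤ → τ k σ < τ l σ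
  candidate : ∀ k σ (i : Fin n), τ k σ = (i : WithTop (Fin n)) → IsCandidate σ i

/-- The net payoff of a single choice with acquisition cost `c`: the possession time less the cost
if the choice is made, and `0` if it is not made. -/
noncomputable def choicePayoff {n : ℕ} (c : ℝ) (σ : Equiv.Perm (Fin n)) : WithTop (Fin n) → ℝ
  | ⊤ => 0
  | (i : Fin n) => duration σ i - c

/-- The expected net payoff of a stopping vector, all `n!` orders being equally likely. -/
noncomputable def expectedNetPayoff {n m : ℕ} (c : ℝ)
    (τ : Fin m → Equiv.Perm (Fin n) → WithTop (Fin n)) : ℝ :=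
  (∑ σ : Equiv.Perm (Fin n), ∑ k : Fin m, choicePayoff c σ (τ k σ)) / (n.factorial : ℝ)

/-- The optimal expected net payoff of the `m`-choice problem with `n` objects and acquisition
cost `c`: the supremum over all stopping vectors (a finite nonempty set). -/
noncomputable def optimalNetPayoff (n m : ℕ) (c : ℝ) : ℝ :=
  sSup {v : ℝ | ∃ τ : Fin m → Equiv.Perm (Fin n) → WithTop (Fin n),
    IsStoppingVector τ ∧ v = expectedNetPayoff c τ}

end DurationProblem

/-!
The event that the object of time `t + 1` is a candidate has probability `1 / (t + 1)` and is
independent of the earlier relative ranks. A candidate at time `i + 1` therefore has the expected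
duration `(i + 1) (1 / (i + 1) + ⋯ + 1 / n)`, and the optimal payoff obeys the recursion
`V (l + 1) i = V (l + 1) (i + 1) + max 0 (g i + V l (i + 1) - V (l + 1) (i + 1)) / (i + 1)`
of dynamic programming.

Divided by `n`, this is the backward Euler scheme of `v' = - max 0 (h + w - v) / x`, `v 1 = 0`,
with `h x = - x log x - c` and `w` the limit for one choice less. Choices near time `0` do not pay,
so the singularity of the equation at `0` is harmless. With unlimited choices every candidate with
`0 < g i` is chosen, and the value is a Riemann sum of `max 0 (h x) / x`, whose integral is
elementary. Having only `l` choices loses at most the fraction `H ^ l / l!` of this value, where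
`H`, the expected number of candidates still to come, stays bounded as `n → ∞`.
-/

namespace DurationProblem

open Finset MeasureTheory
open scoped BigOperators

section RelativeRanks

variable {n : ℕ} {σ τ : Equiv.Perm (Fin n)}

/-- `f` is a function of the relative ranks observed before time `i` only. -/
def DeterminedBefore {α : Type*} (i : ℕ) (f : Equiv.Perm (Fin n) → α) : Prop :=
  ∀ σ τ : Equiv.Perm (Fin n), (∀ j : Fin n, (j : ℕ) < i → relRank σ j = relRank τ j) → f σ = f τ

lemma DeterminedBefore.mono {α : Type*} {i j : ℕ} {f : Equiv.Perm (Fin n) → α}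
    (hf : DeterminedBefore i f) (hij : i ≤ j) : DeterminedBefore j f :=
  fun σ τ h => hf σ τ fun k hk => h k (hk.trans_le hij)

lemma DeterminedBefore.comp {α β : Type*} {i : ℕ} {f : Equiv.Perm (Fin n) → α}
    (hf : DeterminedBefore i f) (φ : α → β) : DeterminedBefore i fun σ => φ (f σ) :=
  fun σ τ h => congrArg φ (hf σ τ h)

lemma DeterminedBefore.map₂ {α β γ : Type*} {i : ℕ} {f : Equiv.Perm (Fin n) → α}
    {g : Equiv.Perm (Fin n) → β} (hf : DeterminedBefore i f) (hg : DeterminedBefore i g)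
    (φ : α → β → γ) : DeterminedBefore i fun σ => φ (f σ) (g σ) :=
  fun σ τ h => congrArg₂ φ (hf σ τ h) (hg σ τ h)

lemma determinedBefore_isCandidate (i : Fin n) :
    DeterminedBefore ((i : ℕ) + 1) fun σ => IsCandidate σ i :=
  fun _ _ h => congrArg (· = 1) (h i (Nat.lt_succ_self _))

theorem apply_lt_apply_iff_of_relRank_eq (h : ∀ i, relRank σ i = relRank τ i) {a b : Fin n}
    (hab : a < b) : σ a < σ b ↔ τ a < τ b := by
  induction b using WellFoundedLT.induction generalizing a with
  | ind b ih =>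
    by_contra hne
    wlog hlt : σ a < σ b ∧ τ b < τ a generalizing σ τ
    · have hσ : σ a ≠ σ b := σ.injective.ne hab.ne
      have hτ : τ a ≠ τ b := τ.injective.ne hab.ne
      have hlt' : τ a < τ b ∧ σ b < σ a := by
        rcases hσ.lt_or_gt with h₁ | h₁ <;> rcases hτ.lt_or_gt with h₂ | h₂ <;>
          simp_all [h₁.not_gt, h₂.not_gt]
      exact this (fun i => (h i).symm) (fun c hc _ hac => (ih c hc hac).symm)
        (fun hiff => hne hiff.symm) hlt'
    let lower (ρ : Equiv.Perm (Fin n)) : Finset (Fin n) := {j | j ≤ b ∧ ρ j ≤ ρ b}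
    have hnot : ¬ lower τ ⊆ lower σ := fun hsub => by
      have heq := eq_of_subset_of_card_le hsub (h b).le
      have ha : a ∈ lower τ := by simp [heq, lower, hab.le, hlt.1.le]
      simp only [lower, mem_filter_univ] at ha
      exact ha.2.not_gt hlt.2
    obtain ⟨a', ha', hna'⟩ := not_subset.1 hnot
    simp only [lower, mem_filter_univ, not_and, not_le] at ha' hna'
    have hτ : τ a' < τ a := ha'.2.trans_lt hlt.2
    have hσ : σ a < σ a' := hlt.1.trans (hna' ha'.1)
    have hb : a' < b := ha'.1.lt_of_ne fun heq => (heq ▸ hna' ha'.1).false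
    rcases lt_trichotomy a a' with h₁ | rfl | h₁
    · exact hτ.not_gt ((ih a' hb h₁).1 hσ)
    · exact hσ.false
    · exact hσ.not_gt ((ih a hab h₁).2 hτ)

theorem relRank_injective (n : ℕ) :
    Function.Injective (relRank : Equiv.Perm (Fin n) → Fin n → ℕ) := by
  intro σ τ h
  have hmono : StrictMono (τ ∘ σ.symm) := fun x y hxy => by
    rcases lt_trichotomy (σ.symm x) (σ.symm y) with hlt | heq | hgt
    · simpa using (apply_lt_apply_iff_of_relRank_eq (congrFun h) hlt).1 (by simpa using hxy)
    · exact absurd (σ.symm.injective heq) hxy.ne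
    · have := (apply_lt_apply_iff_of_relRank_eq (congrFun h) hgt).not.1 (by simpa using hxy.le)
      exact (not_lt.1 this).lt_of_ne fun heq => hgt.ne (τ.injective heq).symm
  have hid : τ ∘ σ.symm = id := (hmono.range_inj strictMono_id).1
    ((σ.symm.trans τ).surjective.range_eq.trans Set.range_id.symm)
  ext1 x
  simpa using (congrFun hid (σ x)).symm

lemma relRank_pos (σ : Equiv.Perm (Fin n)) (i : Fin n) : 0 < relRank σ i :=
  card_pos.2 ⟨i, by simp⟩

lemma relRank_le (σ : Equiv.Perm (Fin n)) (i : Fin n) : relRank σ i ≤ i + 1 :=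
  calc relRank σ i ≤ #(Iic i) := card_le_card fun j => by simp +contextual
    _ = i + 1 := by simp

/-- The sequence of relative ranks of `σ`, with the rank at time `i` shifted to lie in
`{0, …, i}`. -/
def rankCode (σ : Equiv.Perm (Fin n)) (i : Fin n) : Fin (i + 1) :=
  ⟨relRank σ i - 1, by have := relRank_pos σ i; have := relRank_le σ i; omega⟩

lemma val_rankCode_add_one (σ : Equiv.Perm (Fin n)) (i : Fin n) :
    (rankCode σ i : ℕ) + 1 = relRank σ i :=
  Nat.sub_add_cancel (relRank_pos σ i)

lemma rankCode_eq_zero_iff {i : Fin n} : rankCode σ i = 0 ↔ IsCandidate σ i := by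
  rw [IsCandidate, ← val_rankCode_add_one, Fin.ext_iff, Fin.val_zero, Nat.add_eq_right]

theorem rankCode_bijective (n : ℕ) :
    Function.Bijective (rankCode : Equiv.Perm (Fin n) → (i : Fin n) → Fin (i + 1)) := by
  rw [Fintype.bijective_iff_injective_and_card]
  refine ⟨fun σ τ h => relRank_injective n (funext fun i => ?_), ?_⟩
  · rw [← val_rankCode_add_one, ← val_rankCode_add_one, h]
  · simp only [Fintype.card_perm, Fintype.card_pi, Fintype.card_fin]
    rw [Fin.prod_univ_eq_prod_range (· + 1) n, prod_range_add_one_eq_factorial]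

end RelativeRanks

section Independence

lemma expect_ite_eq_of_dependsOn {ι : Type*} [Fintype ι] [DecidableEq ι] {α : ι → Type*}
    [∀ i, Fintype (α i)] [∀ i, DecidableEq (α i)] {i : ι} (a : α i) {F : (∀ j, α j) → ℝ}
    (hF : DependsOn F {i}ᶜ) :
    𝔼 ω, (if ω i = a then F ω else 0) = (𝔼 ω, F ω) / Fintype.card (α i) := by
  let e := (Equiv.piSplitAt i α).symm
  have he (x y) : e (x, y) i = x := by simp [e, Equiv.piSplitAt]
  have hFe (x y) : F (e (x, y)) = F (e (a, y)) := hF fun j hj => by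
    simp [e, Equiv.piSplitAt, show j ≠ i from hj]
  have : Nonempty (α i) := ⟨a⟩
  have hsplit (G : (∀ j, α j) → ℝ) : 𝔼 ω, G ω = 𝔼 y, 𝔼 x, G (e (x, y)) := by
    rw [← Fintype.expect_equiv e (G ∘ e) G fun _ => rfl, ← univ_product_univ, expect_product,
      expect_comm]
    rfl
  simp only [hsplit, he, hFe _ _, Fintype.expect_const, expect_div]
  refine expect_congr rfl fun y _ => ?_
  simp [← div_eq_inv_mul, NNRat.smul_def]

variable {n : ℕ}

open Classical in
theorem expect_ite_isCandidate (i : Fin n) {f : Equiv.Perm (Fin n) → ℝ}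
    (hf : DeterminedBefore i f) :
    𝔼 σ, (if IsCandidate σ i then f σ else 0) = (𝔼 σ, f σ) / ((i : ℝ) + 1) := by
  let e := Equiv.ofBijective _ (rankCode_bijective n)
  have hdep : DependsOn (f ∘ e.symm) {i}ᶜ := fun ω ω' h => hf _ _ fun j hj => by
    have hcode (ω) : rankCode (e.symm ω) j = ω j := congrFun (e.apply_symm_apply ω) j
    rw [← val_rankCode_add_one, ← val_rankCode_add_one, hcode, hcode,
      h j (Fin.ne_of_lt hj)]
  calc 𝔼 σ, (if IsCandidate σ i then f σ else 0)
      = 𝔼 ω, if ω i = 0 then (f ∘ e.symm) ω else 0 :=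
        Fintype.expect_equiv e _ _ fun σ => by
          simp [← rankCode_eq_zero_iff, e]
    _ = (𝔼 ω, (f ∘ e.symm) ω) / Fintype.card (Fin (i + 1)) := expect_ite_eq_of_dependsOn 0 hdep
    _ = (𝔼 σ, f σ) / ((i : ℝ) + 1) := by
        rw [Fintype.card_fin, Nat.cast_add_one,
          Fintype.expect_equiv e.symm (f ∘ e.symm) f fun _ => rfl]

end Independence

section Duration

variable {n : ℕ}

lemma lt_nextCandidate_iff (σ : Equiv.Perm (Fin n)) (i : Fin n) {t : ℕ} (ht : t < n) :
    t < nextCandidate σ i ↔ ∀ j : Fin n, i < j → (j : ℕ) ≤ t → ¬ IsCandidate σ j := by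
  let S : Set ℕ := {t | t = n ∨ ∃ j : Fin n, i < j ∧ IsCandidate σ j ∧ t = j}
  constructor
  · intro h j hij hjt hj
    exact (h.trans_le (Nat.sInf_le (s := S) (Or.inr ⟨j, hij, hj, rfl⟩))).not_ge hjt
  · intro h
    obtain hS | ⟨j, hij, hj, hS⟩ : nextCandidate σ i ∈ S := Nat.sInf_mem ⟨n, Or.inl rfl⟩
    · exact ht.trans_eq hS.symm
    · by_contra hle
      exact h j hij (hS ▸ not_lt.1 hle) hj

lemma nextCandidate_le (σ : Equiv.Perm (Fin n)) (i : Fin n) : nextCandidate σ i ≤ n :=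
  Nat.sInf_le (Or.inl rfl)

lemma lt_nextCandidate (σ : Equiv.Perm (Fin n)) (i : Fin n) : (i : ℕ) < nextCandidate σ i :=
  (lt_nextCandidate_iff σ i i.is_lt).2 fun _ hij hji => absurd hij (Fin.not_lt.2 hji)

lemma succ_lt_nextCandidate_iff (σ : Equiv.Perm (Fin n)) {i : Fin n} {t : ℕ} (hit : (i : ℕ) ≤ t)
    (ht : t + 1 < n) :
    t + 1 < nextCandidate σ i ↔ t < nextCandidate σ i ∧ ¬ IsCandidate σ ⟨t + 1, ht⟩ := by
  rw [lt_nextCandidate_iff σ i ht, lt_nextCandidate_iff σ i (Nat.lt_of_succ_lt ht)]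
  refine ⟨fun h => ⟨fun j hij hjt => h j hij (hjt.trans t.le_succ),
    h _ (Fin.lt_def.2 (Nat.lt_succ_of_le hit)) le_rfl⟩, fun ⟨h₁, h₂⟩ j hij hjt => ?_⟩
  rcases Nat.le_succ_iff.1 hjt with hjt | hjt
  · exact h₁ j hij hjt
  · exact (Fin.ext hjt : j = ⟨t + 1, ht⟩) ▸ h₂

lemma determinedBefore_lt_nextCandidate (i : Fin n) {t : ℕ} (ht : t < n) :
    DeterminedBefore (t + 1) fun σ => t < nextCandidate σ i := by
  intro σ τ h
  simp only [lt_nextCandidate_iff _ i ht]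
  refine propext (forall₃_congr fun j _ hjt => not_congr (iff_of_eq ?_))
  exact (determinedBefore_isCandidate j).mono (Nat.succ_le_succ hjt) σ τ h

theorem expect_ite_lt_nextCandidate (i : Fin n) {f : Equiv.Perm (Fin n) → ℝ}
    (hf : DeterminedBefore ((i : ℕ) + 1) f) {t : ℕ} (hit : (i : ℕ) ≤ t) (ht : t < n) :
    𝔼 σ, (if t < nextCandidate σ i then f σ else 0) = (𝔼 σ, f σ) * ((i + 1) / (t + 1)) := by
  classical
  induction t, hit using Nat.le_induction with
  | base => simp [lt_nextCandidate, div_self (Nat.cast_add_one_ne_zero (R := ℝ) (i : ℕ))]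
  | succ t hit ih =>
    let F (σ : Equiv.Perm (Fin n)) : ℝ := if t < nextCandidate σ i then f σ else 0
    have hF : DeterminedBefore (t + 1) F := fun σ τ h => by
      simp only [F, hf.mono (Nat.succ_le_succ hit) σ τ h,
        iff_of_eq (determinedBefore_lt_nextCandidate i (Nat.lt_of_succ_lt ht) σ τ h)]
    have hsplit (σ) : (if t + 1 < nextCandidate σ i then f σ else 0) =
        F σ - if IsCandidate σ ⟨t + 1, ht⟩ then F σ else 0 := by
      simp only [succ_lt_nextCandidate_iff σ hit ht, F]
      split_ifs <;> simp_all
    simp only [hsplit]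
    rw [expect_sub_distrib, expect_ite_isCandidate ⟨t + 1, ht⟩ hF, ih (Nat.lt_of_succ_lt ht)]
    push_cast
    field

lemma duration_eq_sum (σ : Equiv.Perm (Fin n)) (i : Fin n) :
    duration σ i = ∑ t ∈ Ico (i : ℕ) n, if t < nextCandidate σ i then (1 : ℝ) else 0 := by
  have hfilter : {t ∈ Ico (i : ℕ) n | t < nextCandidate σ i} = Ico (i : ℕ) (nextCandidate σ i) := by
    rw [Ico_filter_lt, min_eq_right (nextCandidate_le σ i)]
  rw [sum_boole, hfilter, Nat.card_Ico, Nat.cast_sub (lt_nextCandidate σ i).le, duration]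

/-- The difference `H n - H i` of harmonic numbers, the discrete counterpart of `log (n / i)`. -/
noncomputable def harmonicTail (n i : ℕ) : ℝ :=
  ∑ t ∈ Ico i n, 1 / ((t : ℝ) + 1)

/-- The expected possession time of a candidate that is chosen at time `i`. -/
noncomputable def expectedDuration (n i : ℕ) : ℝ :=
  ((i : ℝ) + 1) * harmonicTail n i

theorem expect_mul_duration (i : Fin n) {f : Equiv.Perm (Fin n) → ℝ}
    (hf : DeterminedBefore ((i : ℕ) + 1) f) :
    𝔼 σ, f σ * duration σ i = (𝔼 σ, f σ) * expectedDuration n i := by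
  simp only [duration_eq_sum, expectedDuration, harmonicTail, mul_sum, expect_sum_comm]
  refine sum_congr rfl fun t ht => ?_
  obtain ⟨hit, htn⟩ := mem_Ico.1 ht
  simpa [div_eq_mul_inv] using expect_ite_lt_nextCandidate i hf hit htn

lemma expect_mul_duration_sub (i : Fin n) (c : ℝ) {f : Equiv.Perm (Fin n) → ℝ}
    (hf : DeterminedBefore ((i : ℕ) + 1) f) :
    𝔼 σ, f σ * (duration σ i - c) = 𝔼 σ, f σ * (expectedDuration n i - c) := by
  simp only [mul_sub, expect_sub_distrib, expect_mul_duration i hf, expect_mul]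

end Duration

section ChoiceProcess

variable {n m : ℕ}

/-- A choice process describes a way of making at most `m` choices by the numbers `R i` of choices
that are still available just before time `i`. -/
structure IsChoiceProcess (m : ℕ) (R : ℕ → Equiv.Perm (Fin n) → ℕ) : Prop where
  zero : ∀ σ, R 0 σ = m
  step : ∀ (i : Fin n) σ, R (i + 1) σ = R i σ ∨ IsCandidate σ i ∧ R i σ = R (i + 1) σ + 1
  determinedBefore : ∀ i ≤ n, DeterminedBefore i (R i)

/-- The number of choices of the vector `τ` that are not made before time `i`. -/
noncomputable def remainingChoices (τ : Fin m → Equiv.Perm (Fin n) → WithTop (Fin n)) (i : ℕ)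
    (σ : Equiv.Perm (Fin n)) : ℕ :=
  #{k : Fin m | ∀ j : Fin n, (j : ℕ) < i → (j : WithTop (Fin n)) < τ k σ}

lemma measurableSet_rankFiltration_iff (i : Fin n) (p : Equiv.Perm (Fin n) → Prop) :
    MeasurableSet[rankFiltration n i] {σ | p σ} ↔ DeterminedBefore ((i : ℕ) + 1) p := by
  let ranks (σ : Equiv.Perm (Fin n)) (j : {j : Fin n // j ≤ i}) : ℕ := relRank σ j.1
  have hranks (σ τ) : ranks σ = ranks τ ↔
      ∀ j : Fin n, (j : ℕ) < i + 1 → relRank σ j = relRank τ j := by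
    simp [ranks, funext_iff]
  constructor
  · rintro ⟨t, -, ht⟩ σ τ h
    change (σ ∈ {σ | p σ}) = (τ ∈ {σ | p σ})
    rw [← ht]
    exact congrArg t ((hranks σ τ).2 h)
  · refine fun h => ⟨ranks '' {σ | p σ}, MeasurableSpace.measurableSet_top,
      Set.Subset.antisymm ?_ (Set.subset_preimage_image ranks _)⟩
    rintro σ ⟨τ, hτ, hστ⟩
    exact (h τ σ ((hranks τ σ).1 hστ)).mp hτ

lemma remainingChoices_eq_add (τ : Fin m → Equiv.Perm (Fin n) → WithTop (Fin n)) (i : Fin n)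
    (σ : Equiv.Perm (Fin n)) :
    remainingChoices τ i σ = remainingChoices τ (i + 1) σ + #{k | τ k σ = i} := by
  rw [remainingChoices, remainingChoices, ← card_union_of_disjoint]
  · congr 1
    ext k
    simp only [mem_filter_univ, mem_union]
    constructor
    · intro h
      rcases lt_or_ge (i : WithTop (Fin n)) (τ k σ) with hik | hik
      · refine Or.inl fun j hj => ?_
        rcases Nat.lt_succ_iff_lt_or_eq.1 hj with hj | hj
        · exact h j hj
        · exact Fin.ext hj ▸ hik
      · obtain ⟨j, hj, hji⟩ := WithTop.le_coe_iff.1 hik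
        rcases hji.lt_or_eq with hji | rfl
        · exact absurd hj (h j hji).ne'
        · exact Or.inr hj
    · rintro (h | h) j hj
      · exact h j (hj.trans i.val.lt_succ_self)
      · exact h ▸ WithTop.coe_lt_coe.2 hj
  · refine disjoint_filter.2 fun k _ h => (h i i.val.lt_succ_self).ne'

theorem sum_choicePayoff_eq (c : ℝ) (τ : Fin m → Equiv.Perm (Fin n) → WithTop (Fin n))
    (σ : Equiv.Perm (Fin n)) :
    ∑ k, choicePayoff c σ (τ k σ) = ∑ i : Fin n,
      ((remainingChoices τ i σ : ℝ) - remainingChoices τ (i + 1) σ) * (duration σ i - c) := by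
  have hpayoff (x : WithTop (Fin n)) :
      choicePayoff c σ x = ∑ i : Fin n, if x = i then duration σ i - c else 0 := by
    cases x <;> simp [choicePayoff]
  simp only [hpayoff, remainingChoices_eq_add τ _ σ]
  rw [sum_comm]
  refine sum_congr rfl fun i _ => ?_
  rw [← sum_filter, sum_const, nsmul_eq_mul, Nat.cast_add, add_sub_cancel_left]

theorem IsStoppingVector.isChoiceProcess {τ : Fin m → Equiv.Perm (Fin n) → WithTop (Fin n)}
    (hτ : IsStoppingVector τ) : IsChoiceProcess m (remainingChoices τ) where
  zero σ := by simp [remainingChoices]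
  step i σ := by
    rw [remainingChoices_eq_add]
    have hcard : #{k | τ k σ = i} ≤ 1 := card_le_one.2 fun k hk l hl => by
      rw [mem_filter_univ] at hk hl
      rcases lt_trichotomy k l with h | h | h
      · exact absurd (hk.trans hl.symm) (hτ.increasing k l h σ (by simp [hl])).ne
      · exact h
      · exact absurd (hl.trans hk.symm) (hτ.increasing l k h σ (by simp [hk])).ne
    rcases Nat.le_one_iff_eq_zero_or_eq_one.1 hcard with h | h
    · exact Or.inl (by rw [h, add_zero])
    · obtain ⟨k, hk⟩ := card_pos.1 (h.symm ▸ one_pos)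
      exact Or.inr ⟨hτ.candidate k σ i (mem_filter.1 hk).2, by rw [h]⟩
  determinedBefore i _ σ σ' h := by
    refine congrArg card (filter_congr fun k _ => forall₂_congr fun j hj => ?_)
    have hdet := (measurableSet_rankFiltration_iff j fun σ => τ k σ ≤ j).1 (hτ.isStoppingTime k j)
    simpa only [not_le] using not_congr (iff_of_eq (hdet.mono hj σ σ' h))

/-- The time at which a choice process makes its choice number `k + 1`. -/
def choiceTime (R : ℕ → Equiv.Perm (Fin n) → ℕ) (k : Fin m) (σ : Equiv.Perm (Fin n)) :
    WithTop (Fin n) :=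
  ({i : Fin n | R (i + 1) σ + k < m} : Finset (Fin n)).min

namespace IsChoiceProcess

variable {R : ℕ → Equiv.Perm (Fin n) → ℕ}

lemma antitoneOn (hR : IsChoiceProcess m R) (σ : Equiv.Perm (Fin n)) :
    AntitoneOn (R · σ) (Set.Iic n) := by
  refine antitoneOn_of_succ_le Set.ordConnected_Iic fun i _ _ hi => ?_
  rcases hR.step ⟨i, hi⟩ σ with h | ⟨-, h⟩
  · exact h.le
  · exact (Nat.le_succ _).trans h.ge

lemma choiceTime_le_iff (hR : IsChoiceProcess m R) (σ : Equiv.Perm (Fin n)) (k : Fin m)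
    (i : Fin n) : choiceTime R k σ ≤ i ↔ R (i + 1) σ + k < m := by
  constructor
  · intro h
    obtain ⟨j, hj, hji⟩ := WithTop.le_coe_iff.1 h
    have hjm : R (j + 1) σ + k < m := by simpa using mem_of_min hj
    exact (Nat.add_le_add_right (hR.antitoneOn σ j.is_lt i.is_lt (Nat.succ_le_succ hji)) k).trans_lt
      hjm
  · exact fun h => min_le (by simpa using h)

lemma forall_lt_choiceTime_iff (hR : IsChoiceProcess m R) (σ : Equiv.Perm (Fin n)) (k : Fin m)
    {i : ℕ} (hi : i ≤ n) :
    (∀ j : Fin n, (j : ℕ) < i → (j : WithTop (Fin n)) < choiceTime R k σ) ↔ m ≤ R i σ + k := by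
  have hlt (j : Fin n) : (j : WithTop (Fin n)) < choiceTime R k σ ↔ m ≤ R (j + 1) σ + k := by
    rw [← not_le, hR.choiceTime_le_iff, not_lt]
  simp only [hlt]
  rcases i with _ | i
  · simp [hR.zero]
  · refine ⟨fun h => h ⟨i, hi⟩ i.lt_succ_self, fun h j hj => h.trans ?_⟩
    exact Nat.add_le_add_right (hR.antitoneOn σ j.is_lt hi (Nat.succ_le_of_lt hj)) k

lemma remainingChoices_choiceTime (hR : IsChoiceProcess m R) (σ : Equiv.Perm (Fin n)) {i : ℕ}
    (hi : i ≤ n) : remainingChoices (choiceTime (m := m) R) i σ = R i σ := by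
  have hle : R i σ ≤ m := by
    simpa [hR.zero] using hR.antitoneOn σ (Nat.zero_le n) hi (Nat.zero_le i)
  have hmade : #{k : Fin m | (k : ℕ) < m - R i σ} = m - R i σ := by
    rw [Fin.card_filter_val_lt, min_eq_right tsub_le_self]
  have hsum := card_filter_add_card_filter_not (s := univ) fun k : Fin m => (k : ℕ) < m - R i σ
  simp only [remainingChoices, hR.forall_lt_choiceTime_iff σ _ hi, ← tsub_le_iff_left]
  simp only [not_lt, card_univ, Fintype.card_fin] at hsum
  omega

lemma lt_of_choiceTime_eq (hR : IsChoiceProcess m R) {σ : Equiv.Perm (Fin n)} {k : Fin m}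
    {i : Fin n} (hk : choiceTime R k σ = i) : R (i + 1) σ + k < m ∧ m ≤ R i σ + k := by
  rw [← hR.forall_lt_choiceTime_iff σ k i.is_lt.le, ← not_le,
    ← hR.forall_lt_choiceTime_iff σ k i.is_lt, hk]
  exact ⟨fun h => (h i i.val.lt_succ_self).false, fun j hj => WithTop.coe_lt_coe.2 hj⟩

theorem isStoppingVector_choiceTime (hR : IsChoiceProcess m R) :
    IsStoppingVector (choiceTime (m := m) R) where
  isStoppingTime k i := by
    refine (measurableSet_rankFiltration_iff i _).2 fun σ σ' h => ?_
    simp only [hR.choiceTime_le_iff, hR.determinedBefore (i + 1) i.is_lt σ σ' h]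
  increasing k l hkl σ hl := by
    obtain ⟨i, hi⟩ := WithTop.ne_top_iff_exists.1 hl
    obtain ⟨h₁, h₂⟩ := hR.lt_of_choiceTime_eq hi.symm
    by_contra hle
    have hik (j : Fin n) (hj : (j : ℕ) < i) : (j : WithTop (Fin n)) < choiceTime R k σ :=
      (WithTop.coe_lt_coe.2 (Fin.lt_def.2 hj)).trans_le (hi.trans_le (not_lt.1 hle))
    have := (hR.forall_lt_choiceTime_iff σ k i.is_lt.le).1 hik
    have := hR.step i σ
    have : (k : ℕ) < l := hkl
    omega
  candidate k σ i hk := by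
    have := hR.lt_of_choiceTime_eq hk
    rcases hR.step i σ with h | h
    · omega
    · exact h.1

end IsChoiceProcess

end ChoiceProcess

section DynamicProgramming

variable {n m : ℕ}

/-- The value of the problem in which a candidate may be chosen at time `i`, against a reward of
`g i`, when `l` choices are left just before time `i`. -/
noncomputable def value (g : ℕ → ℝ) (n l i : ℕ) : ℝ :=
  if i < n then
    match l with
    | 0 => 0
    | l + 1 => value g n (l + 1) (i + 1) +
        max 0 (g i + value g n l (i + 1) - value g n (l + 1) (i + 1)) / (i + 1)
  else 0
termination_by n - i

/-- The advantage of meeting a candidate at time `i` over meeting none, when `l` choices are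
left. -/
noncomputable def gain (g : ℕ → ℝ) (n : ℕ) : ℕ → ℕ → ℝ
  | 0, _ => 0
  | l + 1, i => max 0 (g i + value g n l (i + 1) - value g n (l + 1) (i + 1))

lemma value_of_le (g : ℕ → ℝ) (l : ℕ) {i : ℕ} (hi : n ≤ i) : value g n l i = 0 := by
  rw [value.eq_def, if_neg hi.not_gt]

lemma value_zero (g : ℕ → ℝ) (n i : ℕ) : value g n 0 i = 0 := by
  rw [value.eq_def]
  exact ite_self 0

lemma value_succ (g : ℕ → ℝ) (l : ℕ) {i : ℕ} (hi : i < n) :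
    value g n (l + 1) i = value g n (l + 1) (i + 1) +
      max 0 (g i + value g n l (i + 1) - value g n (l + 1) (i + 1)) / (i + 1) := by
  rw [value.eq_def, if_pos hi]

lemma value_eq_add_gain (g : ℕ → ℝ) (l : ℕ) {i : ℕ} (hi : i < n) :
    value g n l i = value g n l (i + 1) + gain g n l i / (i + 1) := by
  cases l with
  | zero => simp [value_zero, gain]
  | succ l => exact value_succ g l hi

lemma gain_nonneg (g : ℕ → ℝ) (n l i : ℕ) : 0 ≤ gain g n l i := by
  cases l with
  | zero => exact le_rfl
  | succ l => exact le_max_left _ _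

open Classical in
/-- The loss of value that a choice process incurs at time `i` by not deciding optimally. -/
noncomputable def regret (g : ℕ → ℝ) (R : ℕ → Equiv.Perm (Fin n) → ℕ) (i : Fin n)
    (σ : Equiv.Perm (Fin n)) : ℝ :=
  (if IsCandidate σ i then gain g n (R i σ) i else 0) + value g n (R i σ) (i + 1) -
    (((R i σ : ℝ) - R (i + 1) σ) * g i + value g n (R (i + 1) σ) (i + 1))

theorem IsChoiceProcess.value_sub_expect (g : ℕ → ℝ) {R : ℕ → Equiv.Perm (Fin n) → ℕ}
    (hR : IsChoiceProcess m R) :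
    value g n m 0 - 𝔼 σ, ∑ i : Fin n, ((R i σ : ℝ) - R (i + 1) σ) * g i =
      𝔼 σ, ∑ i, regret g R i σ := by
  classical
  have hgain (i : Fin n) :
      𝔼 σ, (if IsCandidate σ i then gain g n (R i σ) i else 0) =
        𝔼 σ, (value g n (R i σ) i - value g n (R i σ) (i + 1)) := by
    rw [expect_ite_isCandidate i ((hR.determinedBefore i i.is_lt.le).comp fun l => gain g n l i),
      expect_div]
    exact expect_congr rfl fun σ _ => by rw [value_eq_add_gain g _ i.is_lt, add_sub_cancel_left]
  have htelescope (σ) :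
      ∑ i : Fin n, (value g n (R i σ) i - value g n (R (i + 1) σ) (i + 1)) = value g n m 0 := by
    rw [Fin.sum_univ_eq_sum_range fun i => value g n (R i σ) i - value g n (R (i + 1) σ) (i + 1),
      sum_range_sub' fun i => value g n (R i σ) i, hR.zero, value_of_le g _ le_rfl, sub_zero]
  calc _ = 𝔼 σ, ∑ i : Fin n, ((value g n (R i σ) i - value g n (R (i + 1) σ) (i + 1)) -
          ((R i σ : ℝ) - R (i + 1) σ) * g i) := by
        simp only [sum_sub_distrib, htelescope, expect_sub_distrib, Fintype.expect_const]
    _ = _ := by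
        rw [expect_sum_comm, expect_sum_comm]
        refine sum_congr rfl fun i _ => ?_
        simp only [regret, expect_sub_distrib, expect_add_distrib, hgain]
        ring

lemma IsChoiceProcess.regret_nonneg (g : ℕ → ℝ) {R : ℕ → Equiv.Perm (Fin n) → ℕ}
    (hR : IsChoiceProcess m R) (i : Fin n) (σ : Equiv.Perm (Fin n)) : 0 ≤ regret g R i σ := by
  rw [regret]
  rcases hR.step i σ with h | ⟨hcand, h⟩
  · simp only [h, sub_self, zero_mul, zero_add, add_sub_cancel_right]
    split_ifs
    exacts [gain_nonneg g n _ i, le_rfl]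
  · have := le_max_right 0 (g i + value g n (R (i + 1) σ) (i + 1) -
      value g n (R (i + 1) σ + 1) (i + 1))
    rw [if_pos hcand, h, gain]
    push_cast
    linarith

open Classical in
/-- The choice process that chooses a candidate whenever its reward exceeds the value of the
choice that it uses up. -/
noncomputable def greedyProcess (g : ℕ → ℝ) (n m : ℕ) : ℕ → Equiv.Perm (Fin n) → ℕ
  | 0, _ => m
  | i + 1, σ =>
    match greedyProcess g n m i σ with
    | 0 => 0
    | l + 1 => if (∃ h : i < n, IsCandidate σ ⟨i, h⟩) ∧
        value g n (l + 1) (i + 1) ≤ g i + value g n l (i + 1) then l else l + 1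

lemma isChoiceProcess_greedyProcess (g : ℕ → ℝ) (n m : ℕ) :
    IsChoiceProcess m (greedyProcess g n m) where
  zero _ := rfl
  step i σ := by
    rw [greedyProcess]
    cases greedyProcess g n m i σ with
    | zero => exact Or.inl rfl
    | succ l =>
      dsimp only
      split_ifs with h
      exacts [Or.inr ⟨h.1.2, rfl⟩, Or.inl rfl]
  determinedBefore i hi := by
    induction i with
    | zero => exact fun _ _ _ => rfl
    | succ i ih =>
      intro σ τ h
      have hcand := determinedBefore_isCandidate ⟨i, hi⟩ σ τ h
      have hprev := (ih (Nat.le_of_succ_le hi)).mono i.le_succ σ τ h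
      rw [greedyProcess, greedyProcess, hprev]
      cases greedyProcess g n m i τ with
      | zero => rfl
      | succ l =>
        dsimp only
        congr 2
        exact propext (exists_congr fun _ => iff_of_eq hcand)

lemma regret_greedyProcess (g : ℕ → ℝ) (m : ℕ) (i : Fin n) (σ : Equiv.Perm (Fin n)) :
    regret g (greedyProcess g n m) i σ = 0 := by
  have hi : (∃ h : (i : ℕ) < n, IsCandidate σ ⟨i, h⟩) ↔ IsCandidate σ i :=
    exists_prop_of_true i.is_lt
  rw [regret, greedyProcess]
  cases greedyProcess g n m i σ with
  | zero => simp [gain]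
  | succ l =>
    simp only [hi, gain]
    by_cases hcand : IsCandidate σ i
    · by_cases hle : value g n (l + 1) (i + 1) ≤ g i + value g n l (i + 1)
      · simp [hcand, hle]
      · simp [hcand, hle, (not_le.1 hle).le]
    · simp [hcand]

end DynamicProgramming

section Reduction

variable {n m : ℕ}

theorem expectedNetPayoff_eq_expect (c : ℝ) {τ : Fin m → Equiv.Perm (Fin n) → WithTop (Fin n)}
    (hτ : IsStoppingVector τ) :
    expectedNetPayoff c τ = 𝔼 σ, ∑ i : Fin n,
      ((remainingChoices τ i σ : ℝ) - remainingChoices τ (i + 1) σ) *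
        (expectedDuration n i - c) := by
  have hdet := hτ.isChoiceProcess.determinedBefore
  have hcard : n.factorial = Fintype.card (Equiv.Perm (Fin n)) := by
    rw [Fintype.card_perm, Fintype.card_fin]
  rw [expectedNetPayoff, hcard, ← Fintype.expect_eq_sum_div_card]
  simp only [sum_choicePayoff_eq, expect_sum_comm]
  refine sum_congr rfl fun i _ => expect_mul_duration_sub i c ?_
  exact ((hdet i i.is_lt.le).mono (Nat.le_succ i)).map₂ (hdet (i + 1) i.is_lt)
    fun a b => (a : ℝ) - b

theorem optimalNetPayoff_eq_value (n m : ℕ) (c : ℝ) :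
    optimalNetPayoff n m c = value (fun i => expectedDuration n i - c) n m 0 := by
  let g (i : ℕ) : ℝ := expectedDuration n i - c
  refine IsGreatest.csSup_eq ⟨?_, ?_⟩
  · have hR := isChoiceProcess_greedyProcess g n m
    refine ⟨choiceTime (greedyProcess g n m), hR.isStoppingVector_choiceTime, ?_⟩
    have hregret := hR.value_sub_expect g
    simp only [regret_greedyProcess, sum_const_zero, expect_const_zero, sub_eq_zero] at hregret
    rw [expectedNetPayoff_eq_expect c hR.isStoppingVector_choiceTime]
    refine hregret.trans (expect_congr rfl fun σ _ => sum_congr rfl fun i _ => ?_)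
    rw [hR.remainingChoices_choiceTime σ i.is_lt.le, hR.remainingChoices_choiceTime σ i.is_lt]
  · rintro _ ⟨τ, hτ, rfl⟩
    have hR := hτ.isChoiceProcess
    rw [expectedNetPayoff_eq_expect c hτ, ← sub_nonneg, hR.value_sub_expect g]
    exact expect_nonneg fun σ _ => sum_nonneg fun i _ => hR.regret_nonneg g i σ

end Reduction

section UnlimitedChoices

lemma add_max_div_mono {k g a a' b b' : ℝ} (hk : 1 ≤ k) (ha : a ≤ a') (hb : b ≤ b') :
    a + max 0 (g + b - a) / k ≤ a' + max 0 (g + b' - a') / k := by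
  have hmax : max 0 (g + b - a) ≤ max 0 (g + b' - a') + (a' - a) :=
    max_le (by linarith [le_max_left 0 (g + b' - a')]) (by linarith [le_max_right 0 (g + b' - a')])
  calc a + max 0 (g + b - a) / k ≤ a + (max 0 (g + b' - a') + (a' - a)) / k := by gcongr
    _ = a + max 0 (g + b' - a') / k + (a' - a) / k := by ring
    _ ≤ a + max 0 (g + b' - a') / k + (a' - a) := by gcongr; exact div_le_self (sub_nonneg.2 ha) hk
    _ = a' + max 0 (g + b' - a') / k := by ring

lemma value_le_value_succ (g : ℕ → ℝ) {n i : ℕ} (l : ℕ) (hi : i ≤ n) :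
    value g n l i ≤ value g n (l + 1) i := by
  induction l generalizing i with
  | zero =>
    induction hi using Nat.decreasingInduction with
    | self => simp [value_of_le]
    | of_succ i hi ih =>
      rw [value_zero] at ih ⊢
      rw [value_succ g 0 hi]
      positivity
  | succ l ihl =>
    induction hi using Nat.decreasingInduction with
    | self => simp [value_of_le]
    | of_succ i hi ih =>
      rw [value_succ g l hi, value_succ g (l + 1) hi]
      exact add_max_div_mono (by simp) ih (ihl hi)

lemma value_eq_of_nonpos (g : ℕ → ℝ) {n j : ℕ} (l : ℕ) (hj : j ≤ n) (hg : ∀ i < j, g i ≤ 0) :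
    value g n l 0 = value g n l j := by
  induction j with
  | zero => rfl
  | succ j ih =>
    rw [ih (Nat.le_of_succ_le hj) fun i hi => hg i (hi.trans j.lt_succ_self)]
    cases l with
    | zero => simp [value_zero]
    | succ l =>
      have hle := value_le_value_succ g l hj
      have hgj := hg j j.lt_succ_self
      rw [value_succ g l hj, max_eq_left (by linarith), zero_div, add_zero]

/-- The value from time `i` on of the problem with an unlimited number of choices. -/
noncomputable def unlimitedValue (g : ℕ → ℝ) (n i : ℕ) : ℝ :=
  ∑ t ∈ Ico i n, max 0 (g t) / ((t : ℝ) + 1)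

lemma unlimitedValue_self (g : ℕ → ℝ) (n : ℕ) : unlimitedValue g n n = 0 := by
  simp [unlimitedValue]

lemma unlimitedValue_eq_add (g : ℕ → ℝ) {n i : ℕ} (hi : i < n) :
    unlimitedValue g n i = unlimitedValue g n (i + 1) + max 0 (g i) / ((i : ℝ) + 1) := by
  rw [unlimitedValue, sum_eq_sum_Ico_succ_bot hi, add_comm, unlimitedValue]

lemma unlimitedValue_nonneg (g : ℕ → ℝ) (n i : ℕ) : 0 ≤ unlimitedValue g n i :=
  sum_nonneg fun t _ => by positivity

lemma value_le_unlimitedValue (g : ℕ → ℝ) {n i : ℕ} (l : ℕ) (hi : i ≤ n) :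
    value g n l i ≤ unlimitedValue g n i := by
  cases l with
  | zero => exact (value_zero g n i).trans_le (unlimitedValue_nonneg g n i)
  | succ l =>
    induction hi using Nat.decreasingInduction with
    | self => simp [value_of_le, unlimitedValue_self]
    | of_succ i hi ih =>
      have hmono := value_le_value_succ g l hi
      rw [value_succ g l hi, unlimitedValue_eq_add g hi]
      gcongr
      linarith

lemma unlimitedValue_sub_value_succ_le (g : ℕ → ℝ) {n i : ℕ} (l : ℕ) (hi : i < n) :
    unlimitedValue g n i - value g n (l + 1) i ≤
      unlimitedValue g n (i + 1) - value g n (l + 1) (i + 1) +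
        (unlimitedValue g n (i + 1) - value g n l (i + 1)) / ((i : ℝ) + 1) := by
  have hgain : max 0 (g i) ≤ max 0 (g i + value g n l (i + 1) - value g n (l + 1) (i + 1)) +
      (unlimitedValue g n (i + 1) - value g n l (i + 1)) := by
    have hl := value_le_unlimitedValue g l hi
    have hsucc := value_le_unlimitedValue g (l + 1) hi
    refine max_le ?_ ?_
    · linarith [le_max_left 0 (g i + value g n l (i + 1) - value g n (l + 1) (i + 1))]
    · linarith [le_max_right 0 (g i + value g n l (i + 1) - value g n (l + 1) (i + 1))]
  have hdiv := div_le_div_of_nonneg_right hgain i.cast_add_one_pos.le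
  rw [value_succ g l hi, unlimitedValue_eq_add g hi]
  rw [add_div] at hdiv
  linarith

end UnlimitedChoices

section HarmonicTail

lemma harmonicTail_eq_add {n i : ℕ} (hi : i < n) :
    harmonicTail n i = harmonicTail n (i + 1) + 1 / ((i : ℝ) + 1) := by
  rw [harmonicTail, sum_eq_sum_Ico_succ_bot hi, add_comm, harmonicTail]

lemma harmonicTail_nonneg (n i : ℕ) : 0 ≤ harmonicTail n i :=
  sum_nonneg fun t _ => by positivity

lemma harmonicTail_pow_div_factorial_add_le {n i : ℕ} (l : ℕ) (hi : i < n) :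
    harmonicTail n (i + 1) ^ (l + 1) / ((l + 1).factorial : ℝ) +
        harmonicTail n (i + 1) ^ l / (l.factorial : ℝ) / ((i : ℝ) + 1) ≤
      harmonicTail n i ^ (l + 1) / ((l + 1).factorial : ℝ) := by
  have hH := harmonicTail_nonneg n (i + 1)
  have hbernoulli := pow_add_mul_le_add_pow hH
    (by positivity : 0 ≤ 2 * harmonicTail n (i + 1) + 1 / ((i : ℝ) + 1)) (l + 1)
  have hl : (l.factorial : ℝ) ≠ 0 := by positivity
  rw [harmonicTail_eq_add hi]
  refine le_trans (le_of_eq ?_) (div_le_div_of_nonneg_right hbernoulli (by positivity))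
  rw [Nat.factorial_succ, Nat.add_sub_cancel]
  push_cast
  field_simp

theorem unlimitedValue_sub_value_le (g : ℕ → ℝ) {n i : ℕ} (l : ℕ) (hi : i ≤ n) :
    unlimitedValue g n i - value g n l i ≤
      unlimitedValue g n i * (harmonicTail n i ^ l / (l.factorial : ℝ)) := by
  induction l generalizing i with
  | zero => simp [value_zero]
  | succ l ihl =>
    induction hi using Nat.decreasingInduction with
    | self => simp [unlimitedValue_self, value_of_le]
    | of_succ i hi ih =>
      have := unlimitedValue_nonneg g n (i + 1)
      have hmono : unlimitedValue g n (i + 1) ≤ unlimitedValue g n i := by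
        rw [unlimitedValue_eq_add g hi, le_add_iff_nonneg_right]
        positivity
      have hH := harmonicTail_nonneg n (i + 1)
      calc unlimitedValue g n i - value g n (l + 1) i
          ≤ unlimitedValue g n (i + 1) - value g n (l + 1) (i + 1) +
            (unlimitedValue g n (i + 1) - value g n l (i + 1)) / ((i : ℝ) + 1) :=
            unlimitedValue_sub_value_succ_le g l hi
        _ ≤ unlimitedValue g n (i + 1) *
              (harmonicTail n (i + 1) ^ (l + 1) / ((l + 1).factorial : ℝ)) +
            unlimitedValue g n (i + 1) *
              (harmonicTail n (i + 1) ^ l / (l.factorial : ℝ)) / ((i : ℝ) + 1) := by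
            gcongr
            exact ihl hi
        _ = unlimitedValue g n (i + 1) *
            (harmonicTail n (i + 1) ^ (l + 1) / ((l + 1).factorial : ℝ) +
              harmonicTail n (i + 1) ^ l / (l.factorial : ℝ) / ((i : ℝ) + 1)) := by ring
        _ ≤ unlimitedValue g n i * (harmonicTail n i ^ (l + 1) / ((l + 1).factorial : ℝ)) := by
            gcongr
            · exact unlimitedValue_nonneg g n i
            · exact harmonicTail_pow_div_factorial_add_le l hi

lemma log_div_le_harmonicTail {n i : ℕ} (hi : i ≤ n) :
    Real.log (((n : ℝ) + 1) / (i + 1)) ≤ harmonicTail n i := by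
  induction n, hi using Nat.le_induction with
  | base => simp [harmonicTail]
  | succ n hi ih =>
    have hstep : Real.log (((n : ℝ) + 1 + 1) / (n + 1)) ≤ 1 / ((n : ℝ) + 1) := by
      refine (Real.log_le_sub_one_of_pos (by positivity)).trans_eq ?_
      field
    have hlog : Real.log (((n : ℝ) + 1 + 1) / (i + 1)) =
        Real.log ((n + 1 + 1) / (n + 1)) + Real.log ((n + 1) / (i + 1)) := by
      rw [← Real.log_mul (by positivity) (by positivity), div_mul_div_cancel₀ (by positivity)]
    rw [harmonicTail, sum_Ico_succ_top hi, ← harmonicTail, Nat.cast_succ, hlog,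
      add_comm (harmonicTail n i)]
    exact add_le_add hstep ih

lemma harmonicTail_le_log_div {n i : ℕ} (hi₀ : 0 < i) (hi : i ≤ n) :
    harmonicTail n i ≤ Real.log ((n : ℝ) / i) := by
  have : (0 : ℝ) < i := Nat.cast_pos.2 hi₀
  induction n, hi using Nat.le_induction with
  | base => simp [harmonicTail]
  | succ n hi ih =>
    have hn : (0 : ℝ) < n := Nat.cast_pos.2 (hi₀.trans_le hi)
    have hstep : 1 / ((n : ℝ) + 1) ≤ Real.log (((n : ℝ) + 1) / n) := by
      refine le_of_eq_of_le ?_ (Real.one_sub_inv_le_log_of_pos (by positivity))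
      field
    have hlog : Real.log (((n : ℝ) + 1) / i) = Real.log ((n + 1) / n) + Real.log (n / i) := by
      rw [← Real.log_mul (by positivity) (by positivity), div_mul_div_cancel₀ hn.ne']
    rw [harmonicTail, sum_Ico_succ_top hi, ← harmonicTail, Nat.cast_succ, hlog, add_comm]
    exact add_le_add hstep ih

theorem abs_expectedDuration_div_sub_negMulLog_le {n i : ℕ} (hi : i < n) :
    |expectedDuration n i / n - Real.negMulLog (((i : ℝ) + 1) / n)| ≤ 1 / n := by
  have hn : (0 : ℝ) < n := Nat.cast_pos.2 (pos_of_gt hi)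
  have hlog : Real.negMulLog (((i : ℝ) + 1) / n) = (i + 1) * Real.log (n / (i + 1)) / n := by
    rw [Real.negMulLog, ← inv_div (n : ℝ), Real.log_inv]
    field
  have hlower : Real.log ((n : ℝ) / (i + 1)) ≤ harmonicTail n i := by
    refine (Real.log_le_log (by positivity) ?_).trans (log_div_le_harmonicTail hi.le)
    gcongr
    simp
  have hupper : harmonicTail n i ≤ Real.log ((n : ℝ) / (i + 1)) + 1 / (i + 1) := by
    rw [harmonicTail_eq_add hi]
    gcongr
    exact_mod_cast harmonicTail_le_log_div i.succ_pos hi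
  have hexp : expectedDuration n i / n - Real.negMulLog (((i : ℝ) + 1) / n) =
      (i + 1) * (harmonicTail n i - Real.log (n / (i + 1))) / n := by
    rw [hlog, expectedDuration]
    ring
  rw [hexp, abs_of_nonneg (by have := sub_nonneg.2 hlower; positivity)]
  gcongr
  rw [← sub_le_iff_le_add'] at hupper
  exact (mul_le_mul_of_nonneg_left hupper (by positivity)).trans_eq (by field)

end HarmonicTail

end DurationProblem

namespace DurationProblem

open Filter Set Topology
open scoped NNReal

section EulerScheme

variable {δ : ℝ}

/-- The grid functions `i ↦ a n i` converge to `v` uniformly on the points `i / n` of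
`[δ, 1]`. -/
def GridConverges (δ : ℝ) (a : ℕ → ℕ → ℝ) (v : ℝ → ℝ) : Prop :=
  ∀ ε > 0, ∀ᶠ n : ℕ in atTop, ∀ i ≤ n, δ * n ≤ i → |a n i - v ((i : ℝ) / n)| ≤ ε

lemma div_mem_Icc {i n : ℕ} (hn : 0 < n) (hi : i ≤ n) (hδ : δ * n ≤ i) :
    (i : ℝ) / n ∈ Icc δ 1 :=
  ⟨(le_div_iff₀ (Nat.cast_pos.2 hn)).2 hδ, div_le_one_of_le₀ (Nat.cast_le.2 hi) n.cast_nonneg⟩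

lemma ceil_mul_le (hδ₁ : δ ≤ 1) (n : ℕ) : ⌈δ * n⌉₊ ≤ n :=
  Nat.ceil_le.2 (mul_le_of_le_one_left n.cast_nonneg hδ₁)

lemma GridConverges.tendsto {a : ℕ → ℕ → ℝ} {v : ℝ → ℝ} (ha : GridConverges δ a v)
    (hδ₀ : 0 ≤ δ) (hδ₁ : δ ≤ 1) (hv : ContinuousWithinAt v (Icc δ 1) δ) :
    Tendsto (fun n : ℕ => a n ⌈δ * n⌉₊) atTop (𝓝 (v δ)) := by
  have hclose : Tendsto (fun n : ℕ => a n ⌈δ * n⌉₊ - v ((⌈δ * n⌉₊ : ℝ) / n)) atTop (𝓝 0) := by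
    refine Metric.nhds_basis_closedBall.tendsto_right_iff.2 fun ε hε => ?_
    filter_upwards [ha ε hε] with n hn
    rw [mem_closedBall_zero_iff]
    exact hn _ (ceil_mul_le hδ₁ n) (Nat.le_ceil _)
  have hgrid : Tendsto (fun n : ℕ => (⌈δ * n⌉₊ : ℝ) / n) atTop (𝓝[Icc δ 1] δ) := by
    refine tendsto_nhdsWithin_iff.2
      ⟨(tendsto_nat_ceil_mul_div_atTop hδ₀).comp tendsto_natCast_atTop_atTop, ?_⟩
    filter_upwards [eventually_gt_atTop 0] with n hn
    exact div_mem_Icc hn (ceil_mul_le hδ₁ n) (Nat.le_ceil _)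
  simpa using hclose.add (hv.tendsto.comp hgrid)

lemma le_mul_exp_of_le_one_add_mul_add {e : ℕ → ℝ} {L b : ℝ} {i n : ℕ} (hL : 0 ≤ L) (hb : 0 ≤ b)
    (hi : i ≤ n) (hn : e n ≤ 0)
    (he : ∀ j, i ≤ j → j < n → e j ≤ (1 + L) * e (j + 1) + b) :
    e i ≤ (n - i) * b * Real.exp (L * (n - i)) := by
  induction hi using Nat.decreasingInduction with
  | self => simpa using hn
  | of_succ i hi ih =>
    have hi' : (0 : ℝ) ≤ n - (i + 1 : ℕ) := sub_nonneg.2 (Nat.cast_le.2 hi)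
    have hsub : (n : ℝ) - i = n - (i + 1 : ℕ) + 1 := by
      rw [Nat.cast_succ]
      ring
    have hexp : Real.exp (L * (n - i)) = Real.exp L * Real.exp (L * (n - (i + 1 : ℕ))) := by
      rw [← Real.exp_add, hsub]
      ring_nf
    have hone : 1 ≤ Real.exp (L * (n - i)) := Real.one_le_exp (mul_nonneg hL (by linarith))
    calc e i ≤ (1 + L) * e (i + 1) + b := he i le_rfl hi
      _ ≤ (1 + L) * ((n - (i + 1 : ℕ)) * b * Real.exp (L * (n - (i + 1 : ℕ)))) + b := by
        gcongr
        exact ih fun j hj => he j (Nat.le_of_succ_le hj)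
      _ ≤ Real.exp L * ((n - (i + 1 : ℕ)) * b * Real.exp (L * (n - (i + 1 : ℕ)))) +
          b * Real.exp (L * (n - i)) := by
        gcongr
        · exact (add_comm 1 L).trans_le (Real.add_one_le_exp L)
        · exact le_mul_of_one_le_right hb hone
      _ = (n - i) * b * Real.exp (L * (n - i)) := by
        rw [hexp, hsub]
        ring

lemma abs_sub_add_mul_le_of_hasDerivWithinAt {v f : ℝ → ℝ} {x y ε : ℝ} (hxy : x ≤ y)
    (hv : ∀ t ∈ Icc x y, HasDerivWithinAt v (-f t) (Icc x y) t)
    (hf : ∀ t ∈ Icc x y, |f t - f y| ≤ ε) :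
    |v x - (v y + f y * (y - x))| ≤ ε * (y - x) := by
  have hlin : ∀ t ∈ Icc x y,
      HasDerivWithinAt (fun s => v s + f y * s) (-f t + f y) (Icc x y) t := fun t ht => by
    simpa using (hv t ht).fun_add ((hasDerivWithinAt_id t (Icc x y)).const_mul (f y))
  have hbound := (convex_Icc x y).norm_image_sub_le_of_norm_hasDerivWithin_le (C := ε) hlin
    (fun t ht => by simpa [Real.norm_eq_abs, neg_add_eq_sub, abs_sub_comm] using hf t ht)
    (right_mem_Icc.2 hxy) (left_mem_Icc.2 hxy)
  rw [Real.norm_eq_abs, Real.norm_eq_abs, abs_sub_comm x y,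
    abs_of_nonneg (sub_nonneg.2 hxy)] at hbound
  refine le_of_eq_of_le ?_ hbound
  ring_nf

lemma eventually_abs_sub_add_div_le {v f : ℝ → ℝ} (hf : ContinuousOn f (Icc δ 1))
    (hv : ∀ x ∈ Icc δ 1, HasDerivWithinAt v (-f x) (Icc δ 1) x) {ε : ℝ} (hε : 0 < ε) :
    ∀ᶠ n : ℕ in atTop, ∀ i < n, δ * n ≤ i →
      |v ((i : ℝ) / n) - (v (((i + 1 : ℕ) : ℝ) / n) + f (((i + 1 : ℕ) : ℝ) / n) / n)| ≤ ε / n := by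
  obtain ⟨η, hη₀, hη⟩ := Metric.uniformContinuousOn_iff_le.1
    (isCompact_Icc.uniformContinuousOn_of_continuous hf) ε hε
  filter_upwards [tendsto_one_div_atTop_nhds_zero_nat.eventually_le_const hη₀] with n hn i hi hδ
  have hδ' : δ * n ≤ (i + 1 : ℕ) := hδ.trans (Nat.cast_le.2 i.le_succ)
  have hx := div_mem_Icc (pos_of_gt hi) hi.le hδ
  have hy := div_mem_Icc (pos_of_gt hi) hi hδ'
  have hstep : ((i + 1 : ℕ) : ℝ) / n - (i : ℝ) / n = 1 / n := by
    rw [Nat.cast_succ]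
    ring
  have hxy : (i : ℝ) / n ≤ ((i + 1 : ℕ) : ℝ) / n := by
    gcongr
    exact i.le_succ
  have hsub : Icc ((i : ℝ) / n) (((i + 1 : ℕ) : ℝ) / n) ⊆ Icc δ 1 := Icc_subset_Icc hx.1 hy.2
  have hbound := abs_sub_add_mul_le_of_hasDerivWithinAt hxy
    (fun t ht => (hv t (hsub ht)).mono hsub) fun t ht => hη t (hsub ht) _ hy <|
      (Real.dist_le_of_mem_Icc ht (right_mem_Icc.2 hxy)).trans (hstep.trans_le hn)
  rwa [hstep, mul_one_div, mul_one_div] at hbound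

lemma abs_sub_le_of_lipschitzWith {φ : ℝ → ℝ} {L : ℝ≥0} (hφ : LipschitzWith L φ)
    {x x' y y' r ε : ℝ} (hr : 0 ≤ r) (hx : |x - (x' + φ x' / r)| ≤ ε)
    (hy : |y - (y' + φ y' / r)| ≤ ε) : |x - y| ≤ (1 + L / r) * |x' - y'| + 2 * ε := by
  have hLip := hφ.dist_le_mul x' y'
  rw [Real.dist_eq, Real.dist_eq] at hLip
  have hstep : |x' + φ x' / r - (y' + φ y' / r)| ≤ |x' - y'| + L * |x' - y'| / r := by
    rw [add_sub_add_comm, ← sub_div]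
    refine (abs_add_le _ _).trans ?_
    rw [abs_div, abs_of_nonneg hr]
    gcongr
  have htri₁ := abs_sub_le x (x' + φ x' / r) y
  have htri₂ := abs_sub_le (x' + φ x' / r) (y' + φ y' / r) y
  rw [abs_sub_comm] at hy
  linear_combination hx + hy + hstep + htri₁ + htri₂

theorem gridConverges_of_hasDerivWithinAt {F : ℝ → ℝ → ℝ} {L : ℝ≥0} {a : ℕ → ℕ → ℝ} {v : ℝ → ℝ}
    (hF : ∀ x ∈ Icc δ 1, LipschitzWith L (F x))
    (hFv : ContinuousOn (fun x => F x (v x)) (Icc δ 1))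
    (hv : ∀ x ∈ Icc δ 1, HasDerivWithinAt v (-F x (v x)) (Icc δ 1) x)
    (ha₁ : ∀ n, a n n = v 1)
    (ha : ∀ ε > 0, ∀ᶠ n : ℕ in atTop, ∀ i < n, δ * n ≤ i →
      |a n i - (a n (i + 1) + F (((i + 1 : ℕ) : ℝ) / n) (a n (i + 1)) / n)| ≤ ε / n) :
    GridConverges δ a v := by
  intro ε hε
  set ε' := ε / (2 * Real.exp L) with hε'
  have hε'₀ : 0 < ε' := by positivity
  filter_upwards [ha ε' hε'₀, eventually_abs_sub_add_div_le hFv hv hε'₀,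
    eventually_gt_atTop 0] with n han hvn hn i hi hδ
  have hn' : (0 : ℝ) < n := Nat.cast_pos.2 hn
  have hstep : ∀ j, i ≤ j → j < n → |a n j - v ((j : ℝ) / n)| ≤
      (1 + L / n) * |a n (j + 1) - v (((j + 1 : ℕ) : ℝ) / n)| + 2 * ε' / n := by
    intro j hij hj
    have hδj : δ * n ≤ j := hδ.trans (Nat.cast_le.2 hij)
    have hδj' : δ * n ≤ (j + 1 : ℕ) := hδj.trans (Nat.cast_le.2 j.le_succ)
    have hLip := abs_sub_le_of_lipschitzWith (hF _ (div_mem_Icc hn hj hδj')) n.cast_nonneg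
      (han j hj hδj) (hvn j hj hδj)
    rwa [← mul_div_assoc] at hLip
  have hend : |a n n - v ((n : ℝ) / n)| ≤ 0 := by simp [ha₁, div_self hn'.ne']
  calc |a n i - v ((i : ℝ) / n)|
      ≤ (n - i) * (2 * ε' / n) * Real.exp (L / n * (n - i)) :=
        le_mul_exp_of_le_one_add_mul_add (by positivity) (by positivity) hi hend hstep
    _ ≤ n * (2 * ε' / n) * Real.exp (L / n * n) := by
        gcongr <;> exact sub_le_self _ i.cast_nonneg
    _ = ε := by
        rw [hε']
        field_simp

end EulerScheme

section LimitEquation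

variable {δ : ℝ}

lemma lipschitzWith_max_sub_div {x : ℝ} (hδ₀ : 0 < δ) (hx : δ ≤ x) (s : ℝ) :
    LipschitzWith (1 / δ).toNNReal fun y => max 0 (s - y) / x := by
  have hx₀ : 0 < x := hδ₀.trans_le hx
  refine LipschitzWith.of_dist_le_mul fun y z => ?_
  have hmax := abs_max_sub_max_le_abs (s - y) (s - z) 0
  rw [max_comm _ 0, max_comm _ 0, sub_sub_sub_cancel_left, abs_sub_comm z y] at hmax
  rw [Real.dist_eq, Real.dist_eq, ← sub_div, abs_div, abs_of_pos hx₀,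
    Real.coe_toNNReal _ (by positivity), one_div_mul_eq_div]
  gcongr

lemma continuousOn_max_div {a b : ℝ} (ha : 0 < a) {f : ℝ → ℝ} (hf : ContinuousOn f (Icc a b)) :
    ContinuousOn (fun x => max 0 (f x) / x) (Icc a b) :=
  (continuousOn_const.sup hf).div continuousOn_id fun _ hx => (ha.trans_le hx.1).ne'

lemma isPicardLindelof_neg_max_div (hδ₀ : 0 < δ) (hδ₁ : δ ≤ 1) {h : ℝ → ℝ} {M : ℝ} (hM : 0 ≤ M)
    (hh : ContinuousOn h (Icc δ 1)) (hhM : ∀ x ∈ Icc δ 1, h x ≤ M) :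
    IsPicardLindelof (fun x y => -(max 0 (h x - max 0 y) / x)) (tmin := δ) (tmax := 1)
      ⟨1, right_mem_Icc.2 hδ₁⟩ 0 (M / δ * (1 - δ)).toNNReal 0 (M / δ).toNNReal
      (1 / δ).toNNReal where
  lipschitzOnWith x hx := by
    have hLip := (lipschitzWith_max_sub_div hδ₀ hx.1 (h x)).comp (LipschitzWith.id.const_max 0)
    rw [mul_one] at hLip
    exact hLip.neg.lipschitzOnWith
  continuousOn y _ := (continuousOn_max_div hδ₀ (hh.sub continuousOn_const)).neg
  norm_le x hx y _ := by
    have hx₀ : 0 < x := hδ₀.trans_le hx.1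
    rw [norm_neg, Real.norm_of_nonneg (by positivity), Real.coe_toNNReal _ (by positivity)]
    gcongr
    · exact max_le hM (by linarith [hhM x hx, le_max_left 0 y])
    · exact hx.1
  mul_max_le := by
    have : 0 ≤ 1 - δ := sub_nonneg.2 hδ₁
    rw [Real.coe_toNNReal _ (by positivity), Real.coe_toNNReal _ (by positivity)]
    simp [hδ₁]

theorem exists_hasDerivWithinAt_neg_max_div (hδ₀ : 0 < δ) (hδ₁ : δ ≤ 1) {h : ℝ → ℝ}
    (hh : ContinuousOn h (Icc δ 1)) :
    ∃ v : ℝ → ℝ, v 1 = 0 ∧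
      ∀ x ∈ Icc δ 1, HasDerivWithinAt v (-(max 0 (h x - v x) / x)) (Icc δ 1) x := by
  obtain ⟨M, hM⟩ := isCompact_Icc.exists_bound_of_continuousOn hh
  -- Truncating `v` at `0` makes the right-hand side bounded; the solution is nonnegative anyway.
  obtain ⟨v, hv₁, hv⟩ := (isPicardLindelof_neg_max_div hδ₀ hδ₁
    ((norm_nonneg _).trans (hM 1 (right_mem_Icc.2 hδ₁))) hh
    fun x hx => (Real.le_norm_self _).trans (hM x hx)).exists_eq_forall_mem_Icc_hasDerivWithinAt₀
  have hanti : AntitoneOn v (Icc δ 1) := by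
    refine antitoneOn_of_hasDerivWithinAt_nonpos (convex_Icc δ 1) (HasDerivWithinAt.continuousOn hv)
      (fun x hx => (hv x (interior_subset hx)).mono interior_subset) fun x hx => ?_
    have hx₀ : 0 < x := hδ₀.trans_le (interior_subset hx).1
    exact neg_nonpos.2 (by positivity)
  refine ⟨v, hv₁, fun x hx => ?_⟩
  have hvx : 0 ≤ v x := hv₁.ge.trans (hanti hx (right_mem_Icc.2 hδ₁) hx.2)
  simpa only [max_eq_right hvx] using hv x hx

lemma hasDerivWithinAt_integral_left {f : ℝ → ℝ} {a b : ℝ} (hf : ContinuousOn f (Icc a b)) {x : ℝ}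
    (hx : x ∈ Icc a b) :
    HasDerivWithinAt (fun x => ∫ y in x..b, f y) (-f x) (Icc a b) x := by
  have : Fact (x ∈ Icc a b) := ⟨hx⟩
  exact intervalIntegral.integral_hasDerivWithinAt_left
    ((hf.mono (Icc_subset_Icc_left hx.1)).intervalIntegrable_of_Icc hx.2)
    (hf.stronglyMeasurableAtFilter_nhdsWithin measurableSet_Icc x) (hf x hx)

lemma abs_max_div_sub_max_div_le {n i : ℕ} (hδ₀ : 0 < δ) (hi : i < n) (hδ : δ * n ≤ i) (s t : ℝ) :
    |max 0 s / ((i : ℝ) + 1) - max 0 t / (((i + 1 : ℕ) : ℝ) / n) / n| ≤ |s - t| / δ / n := by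
  have hn : (0 : ℝ) < n := Nat.cast_pos.2 (pos_of_gt hi)
  have hmax := abs_max_sub_max_le_abs s t 0
  rw [max_comm _ 0, max_comm _ 0] at hmax
  have hi₀ : (0 : ℝ) < (i : ℝ) + 1 := i.cast_add_one_pos
  rw [div_div, div_mul_cancel₀ _ hn.ne', Nat.cast_succ, ← sub_div, abs_div, abs_of_pos hi₀,
    div_div]
  gcongr
  linarith

end LimitEquation

section LimitValues

variable {δ : ℝ} {g : ℕ → ℕ → ℝ} {G : ℝ → ℝ}

/-- The gains `g n i`, divided by `n`, converge to `G` uniformly on `[δ, 1]`. Times are counted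
from `0` in `g n`, so that `g n i` is the gain from a choice at time `i + 1`. -/
def GainConverges (δ : ℝ) (g : ℕ → ℕ → ℝ) (G : ℝ → ℝ) : Prop :=
  ∀ ε > 0, ∀ᶠ n : ℕ in atTop, ∀ i < n, δ * n ≤ i →
    |g n i / n - G (((i + 1 : ℕ) : ℝ) / n)| ≤ ε

lemma GainConverges.mono {δ' : ℝ} (hg : GainConverges δ g G) (hδ : δ ≤ δ') :
    GainConverges δ' g G := fun ε hε => by
  filter_upwards [hg ε hε] with n hn i hi hi'
  exact hn i hi ((mul_le_mul_of_nonneg_right hδ n.cast_nonneg).trans hi')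

lemma value_succ_div (g : ℕ → ℝ) {n i : ℕ} (l : ℕ) (hi : i < n) :
    value g n (l + 1) i / n = value g n (l + 1) (i + 1) / n +
      max 0 (g i / n + value g n l (i + 1) / n - value g n (l + 1) (i + 1) / n) /
        ((i : ℝ) + 1) := by
  rw [value_succ g l hi, add_div, div_right_comm, ← max_div_div_right n.cast_nonneg, zero_div,
    sub_div, add_div]

lemma unlimitedValue_div (g : ℕ → ℝ) {n i : ℕ} (hi : i < n) :
    unlimitedValue g n i / n = unlimitedValue g n (i + 1) / n +
      max 0 (g i / n) / ((i : ℝ) + 1) := by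
  rw [unlimitedValue_eq_add g hi, add_div, div_right_comm, ← max_div_div_right n.cast_nonneg,
    zero_div]

theorem GridConverges.exists_value_succ (hδ₀ : 0 < δ) (hδ₁ : δ ≤ 1)
    (hG : ContinuousOn G (Icc δ 1)) (hg : GainConverges δ g G) {l : ℕ} {w : ℝ → ℝ}
    (hw : ContinuousOn w (Icc δ 1)) (hwl : GridConverges δ (fun n i => value (g n) n l i / n) w) :
    ∃ v : ℝ → ℝ, ContinuousOn v (Icc δ 1) ∧
      GridConverges δ (fun n i => value (g n) n (l + 1) i / n) v := by
  obtain ⟨v, hv₁, hv⟩ := exists_hasDerivWithinAt_neg_max_div hδ₀ hδ₁ (hG.add hw)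
  have hvc : ContinuousOn v (Icc δ 1) := HasDerivWithinAt.continuousOn hv
  refine ⟨v, hvc, gridConverges_of_hasDerivWithinAt (F := fun x y => max 0 (G x + w x - y) / x)
    (fun x hx => lipschitzWith_max_sub_div hδ₀ hx.1 _)
    (continuousOn_max_div hδ₀ ((hG.add hw).sub hvc)) hv
    (fun n => by rw [value_of_le _ _ le_rfl, zero_div, hv₁]) fun ε hε => ?_⟩
  have hεδ : 0 < ε * δ / 2 := by positivity
  filter_upwards [hg _ hεδ, hwl _ hεδ] with n hgn hwn i hi hδ
  have hgi := hgn i hi hδ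
  have hwi := hwn (i + 1) hi (hδ.trans (Nat.cast_le.2 i.le_succ))
  rw [value_succ_div _ l hi, add_sub_add_left_eq_sub]
  refine (abs_max_div_sub_max_div_le hδ₀ hi hδ _ _).trans ?_
  gcongr
  rw [div_le_iff₀ hδ₀, sub_sub_sub_cancel_right, add_sub_add_comm]
  exact (abs_add_le _ _).trans ((add_le_add hgi hwi).trans_eq (add_halves _))

theorem exists_gridConverges_value (hδ₀ : 0 < δ) (hδ₁ : δ ≤ 1) (hG : ContinuousOn G (Icc δ 1))
    (hg : GainConverges δ g G) (l : ℕ) :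
    ∃ v : ℝ → ℝ, ContinuousOn v (Icc δ 1) ∧
      GridConverges δ (fun n i => value (g n) n l i / n) v := by
  induction l with
  | zero =>
    refine ⟨0, continuousOn_const, fun ε hε => Eventually.of_forall fun n i _ _ => ?_⟩
    simpa [value_zero] using hε.le
  | succ l ih =>
    obtain ⟨w, hw, hwl⟩ := ih
    exact hwl.exists_value_succ hδ₀ hδ₁ hG hg hw

theorem gridConverges_unlimitedValue (hδ₀ : 0 < δ) (hG : ContinuousOn G (Icc δ 1))
    (hg : GainConverges δ g G) :
    GridConverges δ (fun n i => unlimitedValue (g n) n i / n)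
      fun x => ∫ y in x..1, max 0 (G y) / y := by
  have hcont := continuousOn_max_div hδ₀ hG
  refine gridConverges_of_hasDerivWithinAt (F := fun x _ => max 0 (G x) / x) (L := 0)
    (fun _ _ => LipschitzWith.const _) hcont (fun x hx => hasDerivWithinAt_integral_left hcont hx)
    (fun n => by rw [unlimitedValue_self, zero_div, intervalIntegral.integral_same])
    fun ε hε => ?_
  filter_upwards [hg (ε * δ) (by positivity)] with n hgn i hi hδ
  rw [unlimitedValue_div _ hi, add_sub_add_left_eq_sub]
  refine (abs_max_div_sub_max_div_le hδ₀ hi hδ _ _).trans ?_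
  gcongr
  exact (div_le_iff₀ hδ₀).2 (hgn i hi hδ)

lemma harmonicTail_ceil_le (hδ₀ : 0 < δ) (hδ₁ : δ ≤ 1) {n : ℕ} (hn : 0 < n) :
    harmonicTail n ⌈δ * n⌉₊ ≤ Real.log (1 / δ) := by
  have : (0 : ℝ) < n := Nat.cast_pos.2 hn
  have hceil : 0 < ⌈δ * n⌉₊ := Nat.ceil_pos.2 (by positivity)
  refine (harmonicTail_le_log_div hceil (ceil_mul_le hδ₁ n)).trans (Real.log_le_log ?_ ?_)
  · positivity
  · rw [div_le_div_iff₀ (Nat.cast_pos.2 hceil) hδ₀, one_mul, mul_comm]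
    exact Nat.le_ceil _

theorem exists_tendsto_value_div (hδ₀ : 0 < δ) (hδ₁ : δ ≤ 1) (hG : ContinuousOn G (Icc δ 1))
    (hg : GainConverges δ g G) :
    ∃ q : ℕ → ℝ,
      (∀ m, Tendsto (fun n : ℕ => value (g n) n m ⌈δ * n⌉₊ / n) atTop (𝓝 (q m))) ∧
      Tendsto q atTop (𝓝 (∫ y in δ..1, max 0 (G y) / y)) := by
  choose v hvc hv using exists_gridConverges_value hδ₀ hδ₁ hG hg
  have hδ_mem : δ ∈ Icc δ 1 := left_mem_Icc.2 hδ₁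
  have hV := fun m => (hv m).tendsto hδ₀.le hδ₁ (hvc m δ hδ_mem)
  have hU := (gridConverges_unlimitedValue hδ₀ hG hg).tendsto hδ₀.le hδ₁
    (hasDerivWithinAt_integral_left (continuousOn_max_div hδ₀ hG) hδ_mem).continuousWithinAt
  set Q := ∫ y in δ..1, max 0 (G y) / y
  have hupper : ∀ m, v m δ ≤ Q := fun m => le_of_tendsto_of_tendsto' (hV m) hU fun n => by
    have := value_le_unlimitedValue (g n) m (ceil_mul_le hδ₁ n)
    gcongr
  have hlower : ∀ m, Q - Q * (Real.log (1 / δ) ^ m / (m.factorial : ℝ)) ≤ v m δ := fun m => by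
    refine le_of_tendsto_of_tendsto (hU.sub (hU.mul_const _)) (hV m) ?_
    filter_upwards [eventually_gt_atTop 0] with n hn
    have hgap := unlimitedValue_sub_value_le (g n) m (ceil_mul_le hδ₁ n)
    have hU₀ := unlimitedValue_nonneg (g n) n ⌈δ * n⌉₊
    have hH₀ := harmonicTail_nonneg n ⌈δ * n⌉₊
    have hbound : unlimitedValue (g n) n ⌈δ * n⌉₊ - value (g n) n m ⌈δ * n⌉₊ ≤
        unlimitedValue (g n) n ⌈δ * n⌉₊ * (Real.log (1 / δ) ^ m / (m.factorial : ℝ)) := by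
      refine hgap.trans ?_
      gcongr
      exact harmonicTail_ceil_le hδ₀ hδ₁ hn
    rw [sub_le_comm, ← sub_div, div_mul_eq_mul_div]
    gcongr
  have hfactorial := (FloorSemiring.tendsto_pow_div_factorial_atTop (Real.log (1 / δ))).const_mul Q
  rw [mul_zero] at hfactorial
  refine ⟨fun m => v m δ, hV, tendsto_of_tendsto_of_tendsto_of_le_of_le ?_ tendsto_const_nhds
    hlower hupper⟩
  simpa only [sub_zero] using hfactorial.const_sub Q

lemma eventually_value_zero_eq {ρ ε : ℝ} (hg : GainConverges 0 g G) (hε : 0 < ε)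
    (hρ : ∀ x ∈ Icc 0 ρ, G x ≤ -ε) (hδρ : δ < ρ) (hδ₁ : δ ≤ 1) :
    ∀ᶠ n : ℕ in atTop, ∀ m, value (g n) n m 0 = value (g n) n m ⌈δ * n⌉₊ := by
  filter_upwards [hg ε hε, eventually_gt_atTop 0,
    tendsto_one_div_atTop_nhds_zero_nat.eventually_le_const (sub_pos.2 hδρ)] with n hgn hn hstep m
  refine value_eq_of_nonpos _ m (ceil_mul_le hδ₁ n) fun i hi => ?_
  have hn' : (0 : ℝ) < n := Nat.cast_pos.2 hn
  have hiδ : (i : ℝ) / n ≤ δ := (div_le_iff₀ hn').2 (Nat.lt_ceil.1 hi).le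
  have hx : ((i + 1 : ℕ) : ℝ) / n ≤ ρ := by
    rw [Nat.cast_succ, add_div]
    linarith
  have hgi := (abs_le.1 (hgn i (hi.trans_le (ceil_mul_le hδ₁ n)) (by simp))).2
  have hGx := hρ _ ⟨by positivity, hx⟩
  have hgin : g n i / n ≤ 0 := by linarith
  simpa using (div_le_iff₀ hn').1 hgin

lemma max_div_eq_zero {x : ℝ} (hx : G x ≤ 0) : max 0 (G x) / x = 0 := by
  rw [max_eq_left hx, zero_div]

lemma intervalIntegrable_max_div_of_nonpos {a b : ℝ} (hab : a ≤ b)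
    (hG : ∀ x ∈ Icc a b, G x ≤ 0) :
    IntervalIntegrable (fun y => max 0 (G y) / y) MeasureTheory.volume a b :=
  IntervalIntegrable.congr (f := 0) (fun x hx =>
    (max_div_eq_zero (hG x (Ioc_subset_Icc_self (uIoc_of_le hab ▸ hx)))).symm)
    intervalIntegrable_const

lemma integral_max_div_of_nonpos {a b : ℝ} (hab : a ≤ b) (hG : ∀ x ∈ Icc a b, G x ≤ 0) :
    ∫ y in a..b, max 0 (G y) / y = 0 :=
  (intervalIntegral.integral_congr fun x hx =>
    max_div_eq_zero (hG x (uIcc_of_le hab ▸ hx))).trans intervalIntegral.integral_zero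

lemma integral_max_div_eq_of_nonpos (hδ₀ : 0 < δ) (hδ₁ : δ ≤ 1) (hG : ContinuousOn G (Icc δ 1))
    (hGδ : ∀ x ∈ Icc 0 δ, G x ≤ 0) :
    ∫ y in (0 : ℝ)..1, max 0 (G y) / y = ∫ y in δ..1, max 0 (G y) / y := by
  rw [← intervalIntegral.integral_add_adjacent_intervals
    (intervalIntegrable_max_div_of_nonpos hδ₀.le hGδ)
    ((continuousOn_max_div hδ₀ hG).intervalIntegrable_of_Icc hδ₁),
    integral_max_div_of_nonpos hδ₀.le hGδ, zero_add]

theorem exists_tendsto_value_zero_div (hG : Continuous G) (hG₀ : G 0 < 0)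
    (hg : GainConverges 0 g G) :
    ∃ q : ℕ → ℝ,
      (∀ m, Tendsto (fun n : ℕ => value (g n) n m 0 / n) atTop (𝓝 (q m))) ∧
      Tendsto q atTop (𝓝 (∫ y in (0 : ℝ)..1, max 0 (G y) / y)) := by
  obtain ⟨r, hr₀, hr⟩ := Metric.eventually_nhds_iff_ball.1
    (hG.continuousAt.eventually_le_const (show G 0 < G 0 / 2 by linarith))
  set ρ := min (r / 2) 1
  have hρ₀ : 0 < ρ := by positivity
  have hρ : ∀ x ∈ Icc 0 ρ, G x ≤ -(-G 0 / 2) := fun x hx => by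
    rw [neg_div, neg_neg]
    refine hr x ?_
    rw [mem_ball_zero_iff, Real.norm_of_nonneg hx.1]
    linarith [hx.2.trans (min_le_left _ _)]
  have hδ₀ : 0 < ρ / 2 := by positivity
  have hδ₁ : ρ / 2 ≤ 1 := (half_le_self hρ₀.le).trans (min_le_right _ _)
  have hGδ : ∀ x ∈ Icc 0 (ρ / 2), G x ≤ 0 := fun x hx => by
    linarith [hρ x ⟨hx.1, hx.2.trans (half_le_self hρ₀.le)⟩]
  rw [integral_max_div_eq_of_nonpos hδ₀ hδ₁ hG.continuousOn hGδ]
  obtain ⟨q, hq, hlim⟩ := exists_tendsto_value_div hδ₀ hδ₁ hG.continuousOn (hg.mono hδ₀.le)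
  refine ⟨q, fun m => (hq m).congr' ?_, hlim⟩
  filter_upwards [eventually_value_zero_eq hg (by linarith) hρ (half_lt_self hρ₀) hδ₁] with n hn
  rw [hn]

end LimitValues

section LimitIntegral

lemma strictMonoOn_negMulLog : StrictMonoOn Real.negMulLog (Icc 0 (Real.exp (-1))) := by
  refine strictMonoOn_of_deriv_pos (convex_Icc _ _) Real.continuous_negMulLog.continuousOn ?_
  intro x hx
  rw [interior_Icc] at hx
  rw [Real.deriv_negMulLog hx.1.ne']
  linarith [(Real.log_lt_iff_lt_exp hx.1).2 hx.2]

lemma strictAntiOn_negMulLog : StrictAntiOn Real.negMulLog (Ici (Real.exp (-1))) := by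
  refine strictAntiOn_of_deriv_neg (convex_Ici _) Real.continuous_negMulLog.continuousOn ?_
  intro x hx
  rw [interior_Ici] at hx
  have hx₀ : 0 < x := (Real.exp_pos _).trans hx
  rw [Real.deriv_negMulLog hx₀.ne']
  linarith [(Real.lt_log_iff_exp_lt hx₀).2 hx]

lemma negMulLog_exp_neg_one : Real.negMulLog (Real.exp (-1)) = Real.exp (-1) := by
  simp [Real.negMulLog]

variable {c : ℝ}

theorem existsUnique_negMulLog_eq_right (hc₀ : 0 < c) (hc : c ≤ Real.exp (-1)) :
    ∃! x : ℝ, x ∈ Ico (Real.exp (-1)) 1 ∧ Real.negMulLog x = c := by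
  obtain ⟨x, hx, hxc⟩ : c ∈ Real.negMulLog '' Ico (Real.exp (-1)) 1 := by
    refine intermediate_value_Ico' (Real.exp_le_one_iff.2 (by simp))
      Real.continuous_negMulLog.continuousOn ?_
    rwa [Real.negMulLog_one, negMulLog_exp_neg_one, mem_Ioc, and_iff_right hc₀]
  exact ⟨x, ⟨hx, hxc⟩, fun y hy =>
    strictAntiOn_negMulLog.injOn hy.1.1 hx.1 (hy.2.trans hxc.symm)⟩

theorem existsUnique_negMulLog_eq_left (hc₀ : 0 < c) (hc : c ≤ Real.exp (-1)) :
    ∃! x : ℝ, x ∈ Ioc 0 (Real.exp (-1)) ∧ Real.negMulLog x = c := by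
  obtain ⟨x, hx, hxc⟩ : c ∈ Real.negMulLog '' Ioc 0 (Real.exp (-1)) := by
    refine intermediate_value_Ioc (Real.exp_nonneg _) Real.continuous_negMulLog.continuousOn ?_
    rwa [Real.negMulLog_zero, negMulLog_exp_neg_one, mem_Ioc, and_iff_right hc₀]
  exact ⟨x, ⟨hx, hxc⟩, fun y hy => strictMonoOn_negMulLog.injOn (Ioc_subset_Icc_self hy.1)
    (Ioc_subset_Icc_self hx) (hy.2.trans hxc.symm)⟩

lemma integral_negMulLog_sub_div {a b : ℝ} (ha : 0 < a) (hb : 0 < b) :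
    ∫ y in a..b, (Real.negMulLog y - c) / y =
      b + Real.negMulLog b - c * Real.log b - (a + Real.negMulLog a - c * Real.log a) := by
  have hpos : ∀ y ∈ uIcc a b, 0 < y := fun y hy => (lt_min ha hb).trans_le hy.1
  refine intervalIntegral.integral_eq_sub_of_hasDerivAt
    (f := fun y => y + Real.negMulLog y - c * Real.log y) (fun y hy => ?_) ?_
  · have hy := hpos y hy
    refine (((hasDerivAt_id y).add (Real.hasDerivAt_negMulLog hy.ne')).sub
      ((Real.hasDerivAt_log hy.ne').const_mul c)).congr_deriv ?_
    rw [Real.negMulLog]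
    field
  · exact ((Real.continuous_negMulLog.sub continuous_const).continuousOn.div continuousOn_id
      fun y hy => (hpos y hy).ne').intervalIntegrable

theorem integral_max_negMulLog_sub_div {β β' : ℝ} (hβ : β ∈ Ico (Real.exp (-1)) 1)
    (hβc : Real.negMulLog β = c) (hβ' : β' ∈ Ioc 0 (Real.exp (-1)))
    (hβ'c : Real.negMulLog β' = c) :
    ∫ y in (0 : ℝ)..1, max 0 (Real.negMulLog y - c) / y =
      (β - β') * (1 - c ^ 2 / (β * β')) := by
  have hβ₀ : 0 < β := (Real.exp_pos _).trans_le hβ.1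
  have hle : β' ≤ β := hβ'.2.trans hβ.1
  have hcont : Continuous fun y => Real.negMulLog y - c :=
    Real.continuous_negMulLog.sub continuous_const
  have hleft : ∀ y ∈ Icc 0 β', Real.negMulLog y - c ≤ 0 := fun y hy =>
    sub_nonpos.2 <| (strictMonoOn_negMulLog.monotoneOn ⟨hy.1, hy.2.trans hβ'.2⟩
      (Ioc_subset_Icc_self hβ') hy.2).trans_eq hβ'c
  have hright : ∀ y ∈ Icc β 1, Real.negMulLog y - c ≤ 0 := fun y hy =>
    sub_nonpos.2 <| (strictAntiOn_negMulLog.antitoneOn hβ.1 (hβ.1.trans hy.1) hy.1).trans_eq hβc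
  have hmid : ∀ y ∈ Icc β' β, 0 ≤ Real.negMulLog y - c := fun y hy => sub_nonneg.2 <| by
    rcases le_total y (Real.exp (-1)) with h | h
    · exact hβ'c.ge.trans (strictMonoOn_negMulLog.monotoneOn (Ioc_subset_Icc_self hβ')
        ⟨hβ'.1.le.trans hy.1, h⟩ hy.1)
    · exact hβc.ge.trans (strictAntiOn_negMulLog.antitoneOn h hβ.1 hy.2)
  have hlog : ∀ x : ℝ, 0 < x → Real.negMulLog x = c → Real.log x = -c / x := fun x hx hxc => by
    rw [eq_div_iff hx.ne', ← hxc, Real.negMulLog]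
    ring
  calc ∫ y in (0 : ℝ)..1, max 0 (Real.negMulLog y - c) / y
      = ∫ y in β'..1, max 0 (Real.negMulLog y - c) / y :=
        integral_max_div_eq_of_nonpos hβ'.1 (hle.trans hβ.2.le) hcont.continuousOn hleft
    _ = ∫ y in β'..β, max 0 (Real.negMulLog y - c) / y := by
        rw [← intervalIntegral.integral_add_adjacent_intervals
          ((continuousOn_max_div hβ'.1 hcont.continuousOn).intervalIntegrable_of_Icc hle)
          (intervalIntegrable_max_div_of_nonpos hβ.2.le hright),
          integral_max_div_of_nonpos hβ.2.le hright, add_zero]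
    _ = ∫ y in β'..β, (Real.negMulLog y - c) / y :=
        intervalIntegral.integral_congr fun y hy => by
          simp only [max_eq_right (hmid y (uIcc_of_le hle ▸ hy))]
    _ = (β - β') * (1 - c ^ 2 / (β * β')) := by
        have hβ'₀ := hβ'.1
        rw [integral_negMulLog_sub_div hβ'.1 hβ₀, hβc, hβ'c, hlog β hβ₀ hβc, hlog β' hβ'.1 hβ'c]
        field

end LimitIntegral

lemma gainConverges_expectedDuration_sub {c : ℝ} {cost : ℕ → ℝ}
    (hcost : Tendsto (fun n : ℕ => cost n / (n : ℝ)) atTop (𝓝 c)) (δ : ℝ) :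
    GainConverges δ (fun n i => expectedDuration n i - cost n) fun x => Real.negMulLog x - c := by
  intro ε hε
  filter_upwards [Metric.tendsto_nhds.1 hcost (ε / 2) (half_pos hε),
    tendsto_one_div_atTop_nhds_zero_nat.eventually_le_const (half_pos hε)] with n hcn hn i hi _
  rw [sub_div, Nat.cast_succ, sub_sub_sub_comm]
  refine (abs_sub _ _).trans ?_
  have hduration := abs_expectedDuration_div_sub_negMulLog_le hi
  rw [Real.dist_eq] at hcn
  linarith

theorem exists_tendsto_optimalNetPayoff_div {c : ℝ} (hc₀ : 0 < c) {cost : ℕ → ℝ}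
    (hcost : Tendsto (fun n : ℕ => cost n / (n : ℝ)) atTop (𝓝 c)) :
    ∃ q : ℕ → ℝ,
      (∀ m, Tendsto (fun n : ℕ => optimalNetPayoff n m (cost n) / (n : ℝ)) atTop (𝓝 (q m))) ∧
      Tendsto q atTop (𝓝 (∫ y in (0 : ℝ)..1, max 0 (Real.negMulLog y - c) / y)) := by
  simp only [optimalNetPayoff_eq_value]
  exact exists_tendsto_value_zero_div (Real.continuous_negMulLog.sub continuous_const)
    (by simpa using hc₀) (gainConverges_expectedDuration_sub hcost 0)

end DurationProblem

theorem lemma8 (c : ℝ) (hc0 : 0 < c) (hc : c ≤ Real.exp (-1))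
    (cost : ℕ → ℝ)
    (hcost : Filter.Tendsto (fun n : ℕ => cost n / (n : ℝ)) Filter.atTop (nhds c)) :
    (∃! β : ℝ, β ∈ Set.Ico (Real.exp (-1)) 1 ∧ -β * Real.log β = c) ∧
    (∃! β' : ℝ, β' ∈ Set.Ioc 0 (Real.exp (-1)) ∧ -β' * Real.log β' = c) ∧
    ∀ β β' : ℝ,
      β ∈ Set.Ico (Real.exp (-1)) 1 → -β * Real.log β = c →
      β' ∈ Set.Ioc 0 (Real.exp (-1)) → -β' * Real.log β' = c →
      ∃ q : ℕ → ℝ,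
        (∀ m : ℕ, Filter.Tendsto
          (fun n : ℕ => DurationProblem.optimalNetPayoff n m (cost n) / (n : ℝ))
          Filter.atTop (nhds (q m))) ∧
        Filter.Tendsto q Filter.atTop (nhds ((β - β') * (1 - c ^ 2 / (β * β')))) := by
  refine ⟨DurationProblem.existsUnique_negMulLog_eq_right hc0 hc,
    DurationProblem.existsUnique_negMulLog_eq_left hc0 hc, fun β β' hβ hβc hβ' hβ'c => ?_⟩
  rw [← DurationProblem.integral_max_negMulLog_sub_div hβ hβc hβ' hβ'c]
  exact DurationProblem.exists_tendsto_optimalNetPayoff_div hc0 hcost
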